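/- Let $X$ be a smooth manifold of odd dimension $n\ge 3$ with an almost contact metric structure $(\varphi,\vec\xi,\eta,g)$: $\varphi$ is a smooth $(1,1)$-tensor field, $\vec\xi$ a smooth vector field, $\eta$ a smooth 1-form and $g$ a smooth (pseudo-)Riemannian metric with $\eta(\vec\xi)=1$, $\varphi\vec\xi=0$, $\eta\circ\varphi=0$, $\varphi^2\vec x=-\vec x+\eta(\vec x)\vec\xi$ and $g(\varphi\vec x,\varphi\vec y)=g(\vec x,\vec y)-\eta(\vec x)\eta(\vec y)$. The exterior derivative is normalized by $2\,d\eta(\vec x,\vec y)=\vec x\,\eta(\vec y)-\vec y\,\eta(\vec x)-\eta([\vec x,\vec y])$. The structure is called almost contact Hermitian if $$N_\varphi(\vec x,\vec y)+2\,d\eta(\varphi\vec x,\varphi\vec y)\,\vec\xi=0$$ for all vector fields $\vec x,\vec y$, where $N_\varphi(\vec x,\vec y)=[\varphi\vec x,\varphi\vec y]+\varphi^2[\vec x,\vec y]-\varphi[\varphi\vec x,\vec y]-\varphi[\vec x,\varphi\vec y]$; an almost contact Hermitian structure is called almost contact Kählerian if its fundamental form $\Omega(\vec x,\vec y)=g(\vec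 x,\varphi\vec y)$ is closed. Let $\tilde\nabla$ be the Levi-Civita connection of $g$, let $(\tilde\nabla_{\vec x}\varphi)\vec y=\tilde\nabla_{\vec x}(\varphi\vec y)-\varphi(\tilde\nabla_{\vec x}\vec y)$, and let $\psi$ be the field of endomorphisms defined by $g(\psi\vec x,\vec y)=d\eta(\vec y,\vec x)$. Theorem. An almost contact Hermitian structure is almost contact Kählerian if and only if, for all smooth vector fields $\vec x,\vec y$, $$(\tilde\nabla_{\vec x}\varphi)\vec y=d\eta(\varphi\vec y,\vec x)\,\vec\xi+\eta(\vec y)\,(\varphi\circ\psi)(\vec x)+\eta(\vec x)\,(\varphi\circ\psi-\psi\circ\varphi)\vec y .$$ -/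

import Mathlib

open Bundle VectorField FiberBundle
open scoped Manifold ContDiff

noncomputable section

namespace AlmostContact

section General

set_option linter.unusedSectionVars false

variable {E : Type*} [NormedAddCommGroup E] [NormedSpace ℝ E] [FiniteDimensional ℝ E]
  {H : Type*} [TopologicalSpace H] (I : ModelWithCorners ℝ E H)
  (M : Type*) [TopologicalSpace M] [ChartedSpace H M] [IsManifold I ∞ M]

/-- A smooth (pseudo-)Riemannian metric: a smooth field of symmetric nondegenerate bilinear forms
on the tangent spaces. -/
structure PseudoMetric where
  /-- the bilinear form at each point -/
  val (p : M) : TangentSpace I p →L[ℝ] TangentSpace I p →L[ℝ] ℝ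
  symm (p : M) (u v : TangentSpace I p) : val p u v = val p v u
  nondegenerate (p : M) (u : TangentSpace I p) (hu : ∀ v, val p u v = 0) : u = 0
  contMDiff : ContMDiff I (I.prod 𝓘(ℝ, E →L[ℝ] E →L[ℝ] ℝ)) ∞
    (fun p ↦ TotalSpace.mk' (E →L[ℝ] E →L[ℝ] ℝ)
      (E := fun p : M ↦ TangentSpace I p →L[ℝ] TangentSpace I p →L[ℝ] ℝ) p (val p))

variable {I M}

namespace PseudoMetric

variable (g : PseudoMetric I M)

/-- The metric at a point as a bilinear form in the algebraic sense. -/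
def bilin (p : M) : LinearMap.BilinForm ℝ (TangentSpace I p) :=
  LinearMap.mk₂ ℝ (fun u v ↦ g.val p u v) (by simp) (by simp) (by simp) (by simp)

theorem bilin_nondegenerate (p : M) : (g.bilin p).Nondegenerate := by
  refine ⟨fun u hu ↦ g.nondegenerate p u hu, fun u hu ↦ g.nondegenerate p u fun v ↦ ?_⟩
  rw [g.symm]
  exact hu v

/-- Raising an index: the vector `g.sharp p α` is determined by `g (g.sharp p α, v) = α v`. -/
def sharp (p : M) : Module.Dual ℝ (TangentSpace I p) →ₗ[ℝ] TangentSpace I p :=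
  haveI : FiniteDimensional ℝ (TangentSpace I p) := inferInstanceAs (FiniteDimensional ℝ E)
  ((g.bilin p).toDual (g.bilin_nondegenerate p)).symm.toLinearMap

theorem val_sharp (p : M) (α : Module.Dual ℝ (TangentSpace I p)) (v : TangentSpace I p) :
    g.val p (g.sharp p α) v = α v := by
  have : FiniteDimensional ℝ (TangentSpace I p) := inferInstanceAs (FiniteDimensional ℝ E)
  exact LinearMap.BilinForm.apply_toDual_symm_apply (hB := g.bilin_nondegenerate p)
    (f := α) v

theorem mdifferentiableAt_val {p : M} {X Y : Π x : M, TangentSpace I x}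
    (hX : MDiffAt (T% X) p) (hY : MDiffAt (T% Y) p) :
    MDiffAt (fun x ↦ g.val x (X x) (Y x)) p := by
  have hg := (g.contMDiff p).mdifferentiableAt (by simp)
  have := MDifferentiableAt.clm_bundle_apply₂ (F₁ := E) (F₂ := E) (F₃ := ℝ)
    (E₁ := fun x : M ↦ TangentSpace I x) (E₂ := fun x : M ↦ TangentSpace I x)
    (E₃ := Bundle.Trivial M ℝ) (b := fun x ↦ x) hg hX hY
  simp only [mdifferentiableAt_totalSpace] at this
  exact this.2

/-- The right-hand side of the Koszul formula,
`X g(Y,Z) + Y g(Z,X) - Z g(X,Y) + g([X,Y],Z) - g([X,Z],Y) - g([Y,Z],X)`. -/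
def koszul (X Y Z : Π x : M, TangentSpace I x) (p : M) : ℝ :=
  d% (fun x ↦ g.val x (Y x) (Z x)) p (X p) + d% (fun x ↦ g.val x (Z x) (X x)) p (Y p)
    - d% (fun x ↦ g.val x (X x) (Y x)) p (Z p)
    + g.val p (mlieBracket I X Y p) (Z p) - g.val p (mlieBracket I X Z p) (Y p)
    - g.val p (mlieBracket I Y Z p) (X p)

theorem koszul_tensorial_left {p : M} {Y Z : Π x : M, TangentSpace I x}
    (hY : MDiffAt (T% Y) p) (hZ : MDiffAt (T% Z) p) :
    TensorialAt I E (fun X ↦ g.koszul X Y Z p) p where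
  smul {f X} hf hX := by
    have h1 := g.mdifferentiableAt_val hZ hX
    have h2 := g.mdifferentiableAt_val hX hY
    simp [koszul, mvfderiv_fun_mul hf h1, mvfderiv_fun_mul hf h2,
      mlieBracket_smul_left hf hX]
    rw [g.symm p (Z p) (X p)]
    ring
  add {X X'} hX hX' := by
    have h1 := g.mdifferentiableAt_val hZ hX
    have h2 := g.mdifferentiableAt_val hX hY
    have h1' := g.mdifferentiableAt_val hZ hX'
    have h2' := g.mdifferentiableAt_val hX' hY
    simp [koszul, mvfderiv_fun_add h1 h1', mvfderiv_fun_add h2 h2', mlieBracket_add_left hX hX']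
    ring

theorem koszul_tensorial_right {p : M} {X Y : Π x : M, TangentSpace I x}
    (hX : MDiffAt (T% X) p) (hY : MDiffAt (T% Y) p) :
    TensorialAt I E (fun Z ↦ g.koszul X Y Z p) p where
  smul {f Z} hf hZ := by
    have h1 := g.mdifferentiableAt_val hZ hX
    have h2 := g.mdifferentiableAt_val hY hZ
    simp [koszul, mvfderiv_fun_mul hf h1, mvfderiv_fun_mul hf h2,
      mlieBracket_smul_right hf hZ]
    rw [g.symm p (Z p) (X p), g.symm p (Y p) (Z p)]
    ring
  add {Z Z'} hZ hZ' := by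
    have h1 := g.mdifferentiableAt_val hZ hX
    have h2 := g.mdifferentiableAt_val hY hZ
    have h1' := g.mdifferentiableAt_val hZ' hX
    have h2' := g.mdifferentiableAt_val hY hZ'
    simp [koszul, mvfderiv_fun_add h1 h1', mvfderiv_fun_add h2 h2', mlieBracket_add_right hZ hZ']
    ring

theorem koszul_add_middle {p : M} {X Y Y' Z : Π x : M, TangentSpace I x}
    (hX : MDiffAt (T% X) p) (hY : MDiffAt (T% Y) p) (hY' : MDiffAt (T% Y') p)
    (hZ : MDiffAt (T% Z) p) :
    g.koszul X (Y + Y') Z p = g.koszul X Y Z p + g.koszul X Y' Z p := by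
  have h1 := g.mdifferentiableAt_val hY hZ
  have h2 := g.mdifferentiableAt_val hX hY
  have h1' := g.mdifferentiableAt_val hY' hZ
  have h2' := g.mdifferentiableAt_val hX hY'
  simp [koszul, mvfderiv_fun_add h1 h1', mvfderiv_fun_add h2 h2', mlieBracket_add_right hY hY',
    mlieBracket_add_left hY hY']
  ring

theorem koszul_smul_middle {p : M} {X Y Z : Π x : M, TangentSpace I x} {f : M → ℝ}
    (hf : MDiffAt f p) (hX : MDiffAt (T% X) p) (hY : MDiffAt (T% Y) p) (hZ : MDiffAt (T% Z) p) :
    g.koszul X (f • Y) Z p =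
      f p * g.koszul X Y Z p + 2 * (d% f p (X p) * g.val p (Y p) (Z p)) := by
  have h1 := g.mdifferentiableAt_val hY hZ
  have h2 := g.mdifferentiableAt_val hX hY
  simp [koszul, mvfderiv_fun_mul hf h1, mvfderiv_fun_mul hf h2, mlieBracket_smul_right hf hY,
    mlieBracket_smul_left hf hY]
  rw [g.symm p (Y p) (X p)]
  ring

open Classical in
/-- `g.koszulForm Y p u w` is the value at `p` of the Koszul expression for any fields `X`, `Z`,
differentiable at `p`, with `X p = u`, `Z p = w` (for a field `Y` differentiable at `p`; it is `0`
by convention if `Y` is not differentiable at `p`). -/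
def koszulForm (Y : Π x : M, TangentSpace I x) (p : M) :
    TangentSpace I p →L[ℝ] TangentSpace I p →L[ℝ] ℝ :=
  if hY : MDiffAt (T% Y) p then
    TensorialAt.mkHom₂ (fun X Z ↦ g.koszul X Y Z p) p
      (fun _ hZ ↦ g.koszul_tensorial_left hY hZ) (fun _ hX ↦ g.koszul_tensorial_right hX hY)
  else 0

theorem koszulForm_apply {X Y Z : Π x : M, TangentSpace I x} {p : M} (hX : MDiffAt (T% X) p)
    (hY : MDiffAt (T% Y) p) (hZ : MDiffAt (T% Z) p) :
    g.koszulForm Y p (X p) (Z p) = g.koszul X Y Z p := by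
  rw [koszulForm, dif_pos hY]
  exact TensorialAt.mkHom₂_apply _ _ hX hZ

/-- `(∇_u Y)(p)` for a tangent vector `u` at `p`, defined by the Koszul formula
`2 g (∇_X Y, Z) = X g(Y,Z) + Y g(Z,X) - Z g(X,Y) + g([X,Y],Z) - g([X,Z],Y) - g([Y,Z],X)`. -/
def leviCivitaFun (Y : Π x : M, TangentSpace I x) (p : M) :
    TangentSpace I p →L[ℝ] TangentSpace I p :=
  haveI : FiniteDimensional ℝ (TangentSpace I p) := inferInstanceAs (FiniteDimensional ℝ E)
  haveI : T2Space (TangentSpace I p) := inferInstanceAs (T2Space E)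
  LinearMap.toContinuousLinearMap
    (g.sharp p ∘ₗ ContinuousLinearMap.coeLM ℝ ∘ₗ ((1 / 2 : ℝ) • (g.koszulForm Y p)).toLinearMap)

theorem val_leviCivitaFun {X Y Z : Π x : M, TangentSpace I x} {p : M} (hX : MDiffAt (T% X) p)
    (hY : MDiffAt (T% Y) p) (hZ : MDiffAt (T% Z) p) :
    2 * g.val p (g.leviCivitaFun Y p (X p)) (Z p) = g.koszul X Y Z p := by
  have h : g.val p (g.leviCivitaFun Y p (X p)) (Z p) = 1 / 2 * g.koszulForm Y p (X p) (Z p) :=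
    g.val_sharp p _ _
  rw [h, g.koszulForm_apply hX hY hZ]
  ring

theorem ext_val {p : M} {u v : TangentSpace I p}
    (h : ∀ Z : Π x : M, TangentSpace I x, MDiffAt (T% Z) p → g.val p u (Z p) = g.val p v (Z p)) :
    u = v := by
  rw [← sub_eq_zero]
  refine g.nondegenerate p _ fun w ↦ ?_
  have := h (extend E w) (mdifferentiableAt_extend ..)
  simp only [extend_apply_self] at this
  simp [this]

/-- The Levi-Civita connection of a (pseudo-)Riemannian metric. -/
def leviCivita : CovariantDerivative I E (TangentSpace I : M → Type _) where
  toFun := g.leviCivitaFun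
  isCovariantDerivativeOnUniv :=
    { add := by
        intro Y Y' p hY hY' _
        ext u
        refine g.ext_val fun Z hZ ↦ ?_
        have hX := mdifferentiableAt_extend I E u
        have h0 := g.val_leviCivitaFun hX (mdifferentiableAt_add_section hY hY') hZ
        have h1 := g.val_leviCivitaFun hX hY hZ
        have h2 := g.val_leviCivitaFun hX hY' hZ
        rw [g.koszul_add_middle hX hY hY' hZ] at h0
        simp only [extend_apply_self] at h0 h1 h2
        simp only [map_add, add_apply]
        linarith
      leibniz := by
        intro Y f p hY hf _
        ext u
        refine g.ext_val fun Z hZ ↦ ?_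
        have hX := mdifferentiableAt_extend I E u
        have h0 := g.val_leviCivitaFun hX (hf.smul_section hY) hZ
        have h1 := g.val_leviCivitaFun hX hY hZ
        rw [g.koszul_smul_middle hf hX hY hZ] at h0
        simp only [extend_apply_self] at h0 h1
        simp only [add_apply, smul_apply, smul_eq_mul, map_add, map_smul,
          ContinuousLinearMap.smulRight_apply]
        rw [← h1] at h0
        linarith }

theorem val_leviCivita {X Y Z : Π x : M, TangentSpace I x} {p : M} (hX : MDiffAt (T% X) p)
    (hY : MDiffAt (T% Y) p) (hZ : MDiffAt (T% Z) p) :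
    2 * g.val p (g.leviCivita Y p (X p)) (Z p) = g.koszul X Y Z p :=
  g.val_leviCivitaFun hX hY hZ

/-- The Levi-Civita connection is torsion-free. -/
theorem leviCivita_torsion : g.leviCivita.torsion = 0 := by
  rw [CovariantDerivative.torsion_eq_zero_iff]
  intro X Y p hX hY
  refine g.ext_val fun Z hZ ↦ ?_
  have h1 := g.val_leviCivita hX hY hZ
  have h2 := g.val_leviCivita hY hX hZ
  have e1 : ∀ A B : Π x : M, TangentSpace I x,
      (fun x ↦ g.val x (A x) (B x)) = fun x ↦ g.val x (B x) (A x) :=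
    fun A B ↦ funext fun x ↦ g.symm x _ _
  rw [koszul] at h1 h2
  rw [e1 Z X, e1 X Y, e1 Y Z] at h1
  rw [mlieBracket_swap_apply (V := Y) (W := X)] at h2
  simp only [map_sub, map_neg, sub_apply, neg_apply] at *
  linarith

/-- The Levi-Civita connection is compatible with the metric. -/
theorem leviCivita_metric {X Y Z : Π x : M, TangentSpace I x} {p : M} (hX : MDiffAt (T% X) p)
    (hY : MDiffAt (T% Y) p) (hZ : MDiffAt (T% Z) p) :
    d% (fun x ↦ g.val x (Y x) (Z x)) p (X p) =
      g.val p (g.leviCivita Y p (X p)) (Z p) + g.val p (Y p) (g.leviCivita Z p (X p)) := by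
  have h1 := g.val_leviCivita hX hY hZ
  have h2 := g.val_leviCivita hX hZ hY
  have e1 : ∀ A B : Π x : M, TangentSpace I x,
      (fun x ↦ g.val x (A x) (B x)) = fun x ↦ g.val x (B x) (A x) :=
    fun A B ↦ funext fun x ↦ g.symm x _ _
  rw [koszul] at h1 h2
  rw [e1 Z X, e1 X Y] at h1
  rw [e1 Z Y] at h2
  rw [mlieBracket_swap_apply (V := Z) (W := Y)] at h2
  rw [g.symm p (Y p)]
  simp only [map_neg, neg_apply] at *
  linarith

end PseudoMetric

variable (I M) in
/-- An almost contact metric structure `(φ, ξ, η, g)`; all fields are smooth. -/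
structure AlmostContactMetricStructure where
  /-- the structure endomorphism -/
  φ (p : M) : TangentSpace I p →L[ℝ] TangentSpace I p
  /-- the structure vector field -/
  ξ (p : M) : TangentSpace I p
  /-- the contact form -/
  η (p : M) : TangentSpace I p →L[ℝ] ℝ
  /-- the metric -/
  g : PseudoMetric I M
  contMDiff_φ : ContMDiff I (I.prod 𝓘(ℝ, E →L[ℝ] E)) ∞
    (fun p ↦ TotalSpace.mk' (E →L[ℝ] E)
      (E := fun p : M ↦ TangentSpace I p →L[ℝ] TangentSpace I p) p (φ p))
  contMDiff_ξ : ContMDiff I I.tangent ∞ (T% ξ)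
  contMDiff_η : ContMDiff I (I.prod 𝓘(ℝ, E →L[ℝ] ℝ)) ∞
    (fun p ↦ TotalSpace.mk' (E →L[ℝ] ℝ) (E := fun p : M ↦ TangentSpace I p →L[ℝ] ℝ) p (η p))
  η_ξ (p : M) : η p (ξ p) = 1
  φ_ξ (p : M) : φ p (ξ p) = 0
  η_φ (p : M) (u : TangentSpace I p) : η p (φ p u) = 0
  φ_φ (p : M) (u : TangentSpace I p) : φ p (φ p u) = -u + η p u • ξ p
  g_φ_φ (p : M) (u v : TangentSpace I p) :
    g.val p (φ p u) (φ p v) = g.val p u v - η p u * η p v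

namespace AlmostContactMetricStructure

variable (S : AlmostContactMetricStructure I M)

/-- The vector field `φ X`. -/
def φField (X : Π x : M, TangentSpace I x) : Π x : M, TangentSpace I x := fun x ↦ S.φ x (X x)

theorem mdifferentiableAt_η {p : M} {X : Π x : M, TangentSpace I x} (hX : MDiffAt (T% X) p) :
    MDiffAt (fun x ↦ S.η x (X x)) p := by
  have hη := (S.contMDiff_η p).mdifferentiableAt (by simp)
  have := MDifferentiableAt.clm_bundle_apply (F₁ := E) (F₂ := ℝ)
    (E₁ := fun x : M ↦ TangentSpace I x) (E₂ := Bundle.Trivial M ℝ) (b := fun x ↦ x) hη hX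
  simp only [mdifferentiableAt_totalSpace] at this
  exact this.2

/-- `2 dη(X, Y) = X η(Y) - Y η(X) - η([X, Y])` as an operation on vector fields. -/
def dηField (X Y : Π x : M, TangentSpace I x) (p : M) : ℝ :=
  1 / 2 * (d% (fun x ↦ S.η x (Y x)) p (X p) - d% (fun x ↦ S.η x (X x)) p (Y p)
    - S.η p (mlieBracket I X Y p))

theorem dηField_tensorial_left {p : M} {Y : Π x : M, TangentSpace I x} :
    TensorialAt I E (fun X ↦ S.dηField X Y p) p where
  smul {f X} hf hX := by
    simp [dηField, mvfderiv_fun_mul hf (S.mdifferentiableAt_η hX), mlieBracket_smul_left hf hX]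
    ring
  add {X X'} hX hX' := by
    simp [dηField, mvfderiv_fun_add (S.mdifferentiableAt_η hX) (S.mdifferentiableAt_η hX'),
      mlieBracket_add_left hX hX']
    ring

theorem dηField_tensorial_right {p : M} {X : Π x : M, TangentSpace I x} :
    TensorialAt I E (fun Y ↦ S.dηField X Y p) p where
  smul {f Y} hf hY := by
    simp [dηField, mvfderiv_fun_mul hf (S.mdifferentiableAt_η hY), mlieBracket_smul_right hf hY]
    ring
  add {Y Y'} hY hY' := by
    simp [dηField, mvfderiv_fun_add (S.mdifferentiableAt_η hY) (S.mdifferentiableAt_η hY'),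
      mlieBracket_add_right hY hY']
    ring

/-- The exterior derivative `dη` as a 2-form: `2 dη(X, Y) = X η(Y) - Y η(X) - η([X, Y])`. -/
def dη (p : M) : TangentSpace I p →L[ℝ] TangentSpace I p →L[ℝ] ℝ :=
  TensorialAt.mkHom₂ (fun X Y ↦ S.dηField X Y p) p
    (fun _ _ ↦ S.dηField_tensorial_left) (fun _ _ ↦ S.dηField_tensorial_right)

theorem dη_apply {p : M} {X Y : Π x : M, TangentSpace I x} (hX : MDiffAt (T% X) p)
    (hY : MDiffAt (T% Y) p) :
    S.dη p (X p) (Y p) = 1 / 2 * (d% (fun x ↦ S.η x (Y x)) p (X p)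
      - d% (fun x ↦ S.η x (X x)) p (Y p) - S.η p (mlieBracket I X Y p)) :=
  TensorialAt.mkHom₂_apply _ _ hX hY

/-- The endomorphism `ψ` obtained from `dη` by raising an index, see `val_ψ`. -/
def ψ (p : M) : TangentSpace I p →ₗ[ℝ] TangentSpace I p :=
  S.g.sharp p ∘ₗ LinearMap.mk₂ ℝ (fun u v ↦ S.dη p v u) (by simp) (by simp) (by simp) (by simp)

/-- `ψ` is determined by `g(ψ u, v) = dη(v, u)`. -/
theorem val_ψ (p : M) (u v : TangentSpace I p) : S.g.val p (S.ψ p u) v = S.dη p v u :=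
  S.g.val_sharp p _ v

/-- The Nijenhuis torsion `N_φ(X, Y) = [φX, φY] + φ²[X, Y] - φ[φX, Y] - φ[X, φY]`. -/
def nijenhuis (X Y : Π x : M, TangentSpace I x) (p : M) : TangentSpace I p :=
  mlieBracket I (S.φField X) (S.φField Y) p + S.φ p (S.φ p (mlieBracket I X Y p))
    - S.φ p (mlieBracket I (S.φField X) Y p) - S.φ p (mlieBracket I X (S.φField Y) p)

/-- The structure is almost contact Hermitian (almost normal): `N_φ + 2 (dη ∘ φ) ⊗ ξ = 0`, where
`(dη ∘ φ)(X, Y) = dη(φX, φY)`. -/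
def IsAlmostContactHermitian : Prop :=
  ∀ X Y : Π x : M, TangentSpace I x,
    ContMDiff I I.tangent ∞ (T% X) → ContMDiff I I.tangent ∞ (T% Y) →
    ∀ p, S.nijenhuis X Y p + (2 * S.dη p (S.φ p (X p)) (S.φ p (Y p))) • S.ξ p = 0

/-- The fundamental form `Ω(X, Y) = g(X, φY)`, evaluated on vector fields. -/
def Ω (X Y : Π x : M, TangentSpace I x) (p : M) : ℝ := S.g.val p (X p) (S.φ p (Y p))

/-- The exterior derivative of the fundamental form, evaluated on vector fields:
`3 dΩ(X, Y, Z)` is the cyclic sum of `X Ω(Y, Z) - Ω([X, Y], Z)`. -/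
def dΩ (X Y Z : Π x : M, TangentSpace I x) (p : M) : ℝ :=
  1 / 3 * (d% (S.Ω Y Z) p (X p) + d% (S.Ω Z X) p (Y p) + d% (S.Ω X Y) p (Z p)
    - S.Ω (mlieBracket I X Y) Z p - S.Ω (mlieBracket I Y Z) X p - S.Ω (mlieBracket I Z X) Y p)

/-- The structure is almost contact Kählerian: it is almost contact Hermitian and its fundamental
form is closed. -/
def IsAlmostContactKahlerian : Prop :=
  S.IsAlmostContactHermitian ∧
    ∀ X Y Z : Π x : M, TangentSpace I x,
      ContMDiff I I.tangent ∞ (T% X) → ContMDiff I I.tangent ∞ (T% Y) →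
      ContMDiff I I.tangent ∞ (T% Z) → ∀ p, S.dΩ X Y Z p = 0

/-- The Levi-Civita covariant derivative of `φ`: `(∇_X φ) Y = ∇_X (φ Y) - φ (∇_X Y)`. -/
def nablaφ (X Y : Π x : M, TangentSpace I x) (p : M) : TangentSpace I p :=
  S.g.leviCivita (S.φField Y) p (X p) - S.φ p (S.g.leviCivita Y p (X p))

end AlmostContactMetricStructure

end General

end AlmostContact

end

namespace AlmostContact

section SmoothExtension

variable {E : Type*} [NormedAddCommGroup E] [NormedSpace ℝ E] [FiniteDimensional ℝ E]
  {H : Type*} [TopologicalSpace H] (I : ModelWithCorners ℝ E H)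
  {M : Type*} [TopologicalSpace M] [ChartedSpace H M] [IsManifold I ∞ M]

/-- Every tangent vector is the value of a globally defined smooth vector field. -/
theorem exists_contMDiff_vectorField_apply_eq [T2Space M] {p : M} (w : TangentSpace I p) :
    ∃ Z : Π x : M, TangentSpace I x, ContMDiff I I.tangent ∞ (T% Z) ∧ Z p = w := by
  obtain ⟨s, hs, hZ⟩ := exists_contMDiffOn_extend I (k := ∞) E (V := fun x : M ↦ TangentSpace I x) w
  obtain ⟨t, hts, ht, hpt⟩ := mem_nhds_iff.1 hs
  obtain ⟨f, -, hf⟩ := (SmoothBumpFunction.nhds_basis_tsupport (I := I) p).mem_iff.1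
    (ht.mem_nhds hpt)
  refine ⟨(f : M → ℝ) • extend E w, ?_, by simp⟩
  exact ContMDiffOn.smul_section_of_tsupport f.contMDiff.contMDiffOn ht hf (hZ.mono hts)

end SmoothExtension

namespace AlmostContactMetricStructure

section General

variable {E : Type*} [NormedAddCommGroup E] [NormedSpace ℝ E] [FiniteDimensional ℝ E]
  {H : Type*} [TopologicalSpace H] {I : ModelWithCorners ℝ E H}
  {M : Type*} [TopologicalSpace M] [ChartedSpace H M] [IsManifold I ∞ M]
  (S : AlmostContactMetricStructure I M)

set_option linter.unusedSectionVars false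

theorem contMDiff_φField {X : Π x : M, TangentSpace I x} (hX : ContMDiff I I.tangent ∞ (T% X)) :
    ContMDiff I I.tangent ∞ (T% (S.φField X)) :=
  ContMDiff.clm_bundle_apply (F₁ := E) (F₂ := E) (E₁ := fun x : M ↦ TangentSpace I x)
    (E₂ := fun x : M ↦ TangentSpace I x) (b := fun x ↦ x) S.contMDiff_φ hX

theorem mdifferentiableAt_φField {p : M} {X : Π x : M, TangentSpace I x}
    (hX : MDiffAt (T% X) p) : MDiffAt (T% (S.φField X)) p :=
  MDifferentiableAt.clm_bundle_apply (F₁ := E) (F₂ := E) (E₁ := fun x : M ↦ TangentSpace I x)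
    (E₂ := fun x : M ↦ TangentSpace I x) (b := fun x ↦ x)
    ((S.contMDiff_φ p).mdifferentiableAt (by simp)) hX

theorem mdifferentiableAt_ξ (p : M) : MDiffAt (T% S.ξ) p :=
  (S.contMDiff_ξ p).mdifferentiableAt (by simp)

theorem φField_apply (X : Π x : M, TangentSpace I x) (p : M) : S.φField X p = S.φ p (X p) := rfl

theorem g_ξ_left (p : M) (v : TangentSpace I p) : S.g.val p (S.ξ p) v = S.η p v := by
  have := S.g_φ_φ p (S.ξ p) v
  simp only [S.φ_ξ, S.η_ξ, map_zero, zero_apply] at this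
  linarith

theorem g_ξ_right (p : M) (v : TangentSpace I p) : S.g.val p v (S.ξ p) = S.η p v := by
  rw [S.g.symm, g_ξ_left]

/-- The structure endomorphism is skew-adjoint. -/
theorem g_φ_left (p : M) (u v : TangentSpace I p) :
    S.g.val p (S.φ p u) v = -S.g.val p u (S.φ p v) := by
  have := S.g_φ_φ p u (S.φ p v)
  simp only [S.φ_φ, S.η_φ, map_add, map_neg, map_smul, g_ξ_right, smul_eq_mul, mul_zero] at this
  linarith

theorem mlieBracket_eq {p : M} {X Y : Π x : M, TangentSpace I x}
    (hX : MDiffAt (T% X) p) (hY : MDiffAt (T% Y) p) :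
    mlieBracket I X Y p = S.g.leviCivita Y p (X p) - S.g.leviCivita X p (Y p) :=
  ((CovariantDerivative.torsion_eq_zero_iff _).1 S.g.leviCivita_torsion hX hY).symm

/-- The covariant derivative of `φ` is skew-adjoint. -/
theorem val_nablaφ_skew {p : M} {X Y Z : Π x : M, TangentSpace I x}
    (hX : MDiffAt (T% X) p) (hY : MDiffAt (T% Y) p) (hZ : MDiffAt (T% Z) p) :
    S.g.val p (S.nablaφ X Y p) (Z p) = -S.g.val p (S.nablaφ X Z p) (Y p) := by
  have h1 := S.g.leviCivita_metric hX (S.mdifferentiableAt_φField hY) hZ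
  have h2 := S.g.leviCivita_metric hX (S.mdifferentiableAt_φField hZ) hY
  have e : (fun x ↦ S.g.val x (S.φField Y x) (Z x)) =
      -(fun x ↦ S.g.val x (S.φField Z x) (Y x)) := by
    funext x
    simp only [φField_apply, Pi.neg_apply]
    rw [g_φ_left, S.g.symm]
  rw [e, mvfderiv_neg, neg_apply, h2] at h1
  simp only [nablaφ, map_sub, sub_apply, φField_apply, g_φ_left] at h1 ⊢
  rw [S.g.symm p (Z p), S.g.symm p (Y p)] at h1
  simp only [g_φ_left] at h1
  linarith

/-- The covariant derivative of `η` in terms of that of `ξ`. -/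
theorem mvfderiv_η {p : M} {X Y : Π x : M, TangentSpace I x}
    (hX : MDiffAt (T% X) p) (hY : MDiffAt (T% Y) p) :
    d% (fun x ↦ S.η x (Y x)) p (X p) =
      S.g.val p (S.g.leviCivita S.ξ p (X p)) (Y p) + S.η p (S.g.leviCivita Y p (X p)) := by
  have := S.g.leviCivita_metric hX (S.mdifferentiableAt_ξ p) hY
  simpa only [g_ξ_left] using this

/-- `dη` in terms of the covariant derivative of `ξ`. -/
theorem two_mul_dη {p : M} {X Y : Π x : M, TangentSpace I x}
    (hX : MDiffAt (T% X) p) (hY : MDiffAt (T% Y) p) :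
    2 * S.dη p (X p) (Y p) = S.g.val p (S.g.leviCivita S.ξ p (X p)) (Y p)
      - S.g.val p (S.g.leviCivita S.ξ p (Y p)) (X p) := by
  rw [S.dη_apply hX hY, S.mvfderiv_η hX hY, S.mvfderiv_η hY hX, S.mlieBracket_eq hX hY, map_sub]
  ring

/-- The derivative of the identity `φ² = -1 + η ⊗ ξ`. -/
theorem nablaφ_φField {p : M} {X Y : Π x : M, TangentSpace I x}
    (hX : MDiffAt (T% X) p) (hY : MDiffAt (T% Y) p) :
    S.nablaφ X (S.φField Y) p + S.φ p (S.nablaφ X Y p) =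
      S.g.val p (S.g.leviCivita S.ξ p (X p)) (Y p) • S.ξ p
        + S.η p (Y p) • S.g.leviCivita S.ξ p (X p) := by
  have hφφ := S.mdifferentiableAt_φField (S.mdifferentiableAt_φField hY)
  have e : S.φField (S.φField Y) + Y = (fun x ↦ S.η x (Y x)) • S.ξ := by
    funext x
    simp [φField_apply, S.φ_φ]
  have h1 := S.g.leviCivita.isCovariantDerivativeOnUniv.add hφφ hY
  rw [e, S.g.leviCivita.isCovariantDerivativeOnUniv.leibniz (S.mdifferentiableAt_ξ p)
    (S.mdifferentiableAt_η hY)] at h1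
  have h2 := congr($h1 (X p))
  simp only [add_apply, smul_apply, ContinuousLinearMap.smulRight_apply, S.mvfderiv_η hX hY] at h2
  simp only [nablaφ, map_sub, S.φ_φ]
  rw [← sub_eq_zero] at h2 ⊢
  rw [← neg_eq_zero, ← h2]
  module

/-- The Nijenhuis torsion in terms of the covariant derivative of `φ`. -/
theorem nijenhuis_eq {p : M} {X Y : Π x : M, TangentSpace I x}
    (hX : MDiffAt (T% X) p) (hY : MDiffAt (T% Y) p) :
    S.nijenhuis X Y p = S.nablaφ (S.φField X) Y p - S.nablaφ (S.φField Y) X p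
      - S.φ p (S.nablaφ X Y p) + S.φ p (S.nablaφ Y X p) := by
  have hφX := S.mdifferentiableAt_φField hX
  have hφY := S.mdifferentiableAt_φField hY
  simp only [nijenhuis, nablaφ, S.mlieBracket_eq hX hY, S.mlieBracket_eq hφX hY,
    S.mlieBracket_eq hX hφY, S.mlieBracket_eq hφX hφY, map_sub]
  abel

/-- The exterior derivative of the fundamental form in terms of the covariant derivative of `φ`. -/
theorem three_mul_dΩ {p : M} {X Y Z : Π x : M, TangentSpace I x}
    (hX : MDiffAt (T% X) p) (hY : MDiffAt (T% Y) p) (hZ : MDiffAt (T% Z) p) :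
    3 * S.dΩ X Y Z p = -(S.g.val p (S.nablaφ X Y p) (Z p) + S.g.val p (S.nablaφ Y Z p) (X p)
      + S.g.val p (S.nablaφ Z X p) (Y p)) := by
  have h1 := S.g.leviCivita_metric hX hY (S.mdifferentiableAt_φField hZ)
  have h2 := S.g.leviCivita_metric hY hZ (S.mdifferentiableAt_φField hX)
  have h3 := S.g.leviCivita_metric hZ hX (S.mdifferentiableAt_φField hY)
  rw [S.val_nablaφ_skew hX hY hZ, S.val_nablaφ_skew hY hZ hX, S.val_nablaφ_skew hZ hX hY]
  simp only [dΩ, Ω, S.mlieBracket_eq hX hY, S.mlieBracket_eq hY hZ, S.mlieBracket_eq hZ hX]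
  simp only [φField_apply] at h1 h2 h3
  unfold Ω
  rw [h1, h2, h3]
  simp only [nablaφ, map_sub, sub_apply, g_φ_left]
  rw [S.g.symm p (Y p), S.g.symm p (Z p), S.g.symm p (X p)]
  ring

/-- The covariant derivative of `φ` prescribed by `dη` in the almost contact Kählerian case. -/
noncomputable def kahlerNablaφ (p : M) (u v : TangentSpace I p) : TangentSpace I p :=
  S.dη p (S.φ p v) u • S.ξ p + S.η p v • S.φ p (S.ψ p u)
    + S.η p u • (S.φ p (S.ψ p v) - S.ψ p (S.φ p v))

theorem val_kahlerNablaφ (p : M) (u v w : TangentSpace I p) :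
    S.g.val p (S.kahlerNablaφ p u v) w = S.dη p (S.φ p v) u * S.η p w
      - S.η p v * S.dη p (S.φ p w) u
      - S.η p u * (S.dη p (S.φ p w) v + S.dη p w (S.φ p v)) := by
  simp only [kahlerNablaφ, map_add, map_sub, map_smul, add_apply, sub_apply, smul_apply,
    g_ξ_left, g_φ_left, val_ψ, smul_eq_mul]
  ring

theorem dη_swap {p : M} (u v : TangentSpace I p) : S.dη p u v = -S.dη p v u := by
  have h1 := S.two_mul_dη (mdifferentiableAt_extend I E u) (mdifferentiableAt_extend I E v)
  have h2 := S.two_mul_dη (mdifferentiableAt_extend I E v) (mdifferentiableAt_extend I E u)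
  simp only [extend_apply_self] at h1 h2
  linarith

/-- The fundamental form is closed if `∇φ` is the tensor `kahlerNablaφ`. -/
theorem dΩ_eq_zero_of_nablaφ_eq {p : M} {X Y Z : Π x : M, TangentSpace I x}
    (hX : MDiffAt (T% X) p) (hY : MDiffAt (T% Y) p) (hZ : MDiffAt (T% Z) p)
    (hXY : S.nablaφ X Y p = S.kahlerNablaφ p (X p) (Y p))
    (hYZ : S.nablaφ Y Z p = S.kahlerNablaφ p (Y p) (Z p))
    (hZX : S.nablaφ Z X p = S.kahlerNablaφ p (Z p) (X p)) :
    S.dΩ X Y Z p = 0 := by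
  have h := S.three_mul_dΩ hX hY hZ
  rw [hXY, hYZ, hZX] at h
  simp only [val_kahlerNablaφ] at h
  rw [S.dη_swap (Z p) (S.φ p (Y p)), S.dη_swap (X p) (S.φ p (Z p)),
    S.dη_swap (Y p) (S.φ p (X p))] at h
  linarith

/-- `g((∇_X φ) Y, Z)` for an almost contact Kählerian structure. -/
theorem IsAlmostContactKahlerian.val_nablaφ {S : AlmostContactMetricStructure I M}
    (hS : S.IsAlmostContactKahlerian) {X Y Z : Π x : M, TangentSpace I x}
    (hX : ContMDiff I I.tangent ∞ (T% X)) (hY : ContMDiff I I.tangent ∞ (T% Y))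
    (hZ : ContMDiff I I.tangent ∞ (T% Z)) (p : M) :
    S.g.val p (S.nablaφ X Y p) (Z p) = S.g.val p (S.kahlerNablaφ p (X p) (Y p)) (Z p) := by
  have md {W : Π x : M, TangentSpace I x} (hW : ContMDiff I I.tangent ∞ (T% W)) :
      MDiffAt (T% W) p := (hW p).mdifferentiableAt (by simp)
  have hφY := S.contMDiff_φField hY
  have hφZ := S.contMDiff_φField hZ
  have sq {V W : Π x : M, TangentSpace I x} (hV : ContMDiff I I.tangent ∞ (T% V))
      (hW : ContMDiff I I.tangent ∞ (T% W)) (u : TangentSpace I p) :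
      S.g.val p (S.nablaφ V (S.φField W) p) u - S.g.val p (S.nablaφ V W p) (S.φ p u) =
        S.g.val p (S.g.leviCivita S.ξ p (V p)) (W p) * S.η p u
          + S.η p (W p) * S.g.val p (S.g.leviCivita S.ξ p (V p)) u := by
    have := congr(S.g.val p $(S.nablaφ_φField (md hV) (md hW)) u)
    simpa [g_ξ_left, g_φ_left, ← sub_eq_add_neg] using this
  have nξ {V W : Π x : M, TangentSpace I x} (hV : ContMDiff I I.tangent ∞ (T% V))
      (hW : ContMDiff I I.tangent ∞ (T% W)) :
      S.g.val p (S.nablaφ V W p) (S.ξ p) =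
        -S.g.val p (S.g.leviCivita S.ξ p (V p)) (S.φ p (W p)) := by
    have e : S.φField S.ξ = 0 := funext S.φ_ξ
    rw [S.val_nablaφ_skew (md hV) (md hW) (S.mdifferentiableAt_ξ p)]
    simp [nablaφ, e, g_φ_left]
  have d1 := S.three_mul_dΩ (md hX) (md hY) (md hZ)
  have d2 := S.three_mul_dΩ (md hX) (md hφY) (md hφZ)
  rw [hS.2 X Y Z hX hY hZ] at d1
  rw [hS.2 X _ _ hX hφY hφZ] at d2
  have hN := congr(S.g.val p $(hS.1 Y Z hY hZ p) (S.φ p (X p)))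
  rw [S.nijenhuis_eq (md hY) (md hZ)] at hN
  simp only [map_add, map_sub, map_smul, map_zero, add_apply, sub_apply, smul_apply, zero_apply,
    g_φ_left, S.φ_φ, map_neg, g_ξ_left, S.η_φ, smul_eq_mul, nξ hY hZ, nξ hZ hY] at hN
  have s1 := sq hX hY (S.φField Z p)
  have s2 := sq hφY hZ (X p)
  have s3 := sq hφZ hY (X p)
  have k1 := S.val_nablaφ_skew (md hφZ) (md hX) (md hφY)
  have k2 := S.val_nablaφ_skew (md hZ) (md hX) (md hY)
  have e1 := S.two_mul_dη (md hφY) (md hX)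
  have e2 := S.two_mul_dη (md hφZ) (md hX)
  have e3 := S.two_mul_dη (md hφZ) (md hY)
  have e4 := S.two_mul_dη (md hZ) (md hφY)
  simp only [φField_apply, S.φ_φ, S.η_φ, map_add, map_neg, map_smul, smul_eq_mul, nξ hX hY]
    at s1 s2 s3 k1 k2 e1 e2 e3 e4 d2
  rw [val_kahlerNablaφ]
  linear_combination (-1 / 2) * d2 + (1 / 2) * d1 + (1 / 2) * s1 + (1 / 2) * s2 + (1 / 2) * k1
    - (1 / 2) * s3 - (1 / 2) * k2 + (1 / 2) * hN - (1 / 2) * S.η p (Z p) * e1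
    + (1 / 2) * S.η p (Y p) * e2 + (1 / 2) * S.η p (X p) * e3 + (1 / 2) * S.η p (X p) * e4

theorem IsAlmostContactKahlerian.nablaφ_eq [T2Space M] {S : AlmostContactMetricStructure I M}
    (hS : S.IsAlmostContactKahlerian) {X Y : Π x : M, TangentSpace I x}
    (hX : ContMDiff I I.tangent ∞ (T% X)) (hY : ContMDiff I I.tangent ∞ (T% Y)) (p : M) :
    S.nablaφ X Y p = S.kahlerNablaφ p (X p) (Y p) := by
  rw [← sub_eq_zero]
  refine S.g.nondegenerate p _ fun w ↦ ?_
  obtain ⟨Z, hZ, rfl⟩ := exists_contMDiff_vectorField_apply_eq I w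
  rw [map_sub, sub_apply, hS.val_nablaφ hX hY hZ, sub_self]

/-- An almost contact Hermitian structure is almost contact Kählerian if and only if the
covariant derivative of `φ` is the tensor `kahlerNablaφ`. -/
theorem IsAlmostContactHermitian.isAlmostContactKahlerian_iff [T2Space M]
    {S : AlmostContactMetricStructure I M} (hS : S.IsAlmostContactHermitian) :
    S.IsAlmostContactKahlerian ↔ ∀ X Y : Π x : M, TangentSpace I x,
      ContMDiff I I.tangent ∞ (T% X) → ContMDiff I I.tangent ∞ (T% Y) →
      ∀ p, S.nablaφ X Y p = S.kahlerNablaφ p (X p) (Y p) := by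
  refine ⟨fun hK X Y hX hY p ↦ hK.nablaφ_eq hX hY p, fun h ↦ ⟨hS, fun X Y Z hX hY hZ p ↦ ?_⟩⟩
  have md {W : Π x : M, TangentSpace I x} (hW : ContMDiff I I.tangent ∞ (T% W)) :
      MDiffAt (T% W) p := (hW p).mdifferentiableAt (by simp)
  exact S.dΩ_eq_zero_of_nablaφ_eq (md hX) (md hY) (md hZ) (h X Y hX hY p) (h Y Z hY hZ p)
    (h Z X hZ hX p)

end General

end AlmostContactMetricStructure

end AlmostContact

theorem theorem8 {n : ℕ} (hn : 3 ≤ n) (hodd : Odd n)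
    {M : Type*} [TopologicalSpace M] [T2Space M]
    [ChartedSpace (EuclideanSpace ℝ (Fin n)) M] [IsManifold (𝓡 n) ∞ M]
    (S : AlmostContact.AlmostContactMetricStructure (𝓡 n) M)
    (hS : S.IsAlmostContactHermitian) :
    S.IsAlmostContactKahlerian ↔
      ∀ X Y : Π p : M, TangentSpace (𝓡 n) p,
        ContMDiff (𝓡 n) (𝓡 n).tangent ∞ (T% X) → ContMDiff (𝓡 n) (𝓡 n).tangent ∞ (T% Y) →
        ∀ p : M, S.nablaφ X Y p =
          S.dη p (S.φ p (Y p)) (X p) • S.ξ p + S.η p (Y p) • S.φ p (S.ψ p (X p))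
            + S.η p (X p) • (S.φ p (S.ψ p (Y p)) - S.ψ p (S.φ p (Y p))) :=
  hS.isAlmostContactKahlerian_iff
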